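/- Let $X$ be a pointed metric space with base point $0$, let $E,F$ be real Banach spaces, let $1<p\le\infty$ and let $p^*$ be the conjugate exponent of $p$. Let $T\in LipL_0(X\times E;F)$, i.e. $T:X\times E\to F$ with $T(x,\cdot)$ linear for every $x\in X$, $T(0,e)=0$ for every $e\in E$, and $\|T(x,e)-T(y,e)\|\le C\,d(x,y)\|e\|$ for all $x,y\in X$, $e\in E$ and some constant $C>0$. Let $X\boxtimes E$ be the linear span of the functionals $\delta_{(x,y)}\boxtimes e: f\mapsto\langle f(x)-f(y),e\rangle$ ($x,y\in X$, $e\in E$) on the space $Lip_0(X;E^*)$ of Lipschitz maps $X\to E^*$ vanishing at $0$, endowed with the norm $\pi(u)=\inf\{\sum_{i=1}^n d(x_i,y_i)\|e_i\| : u=\sum_{i=1}^n\delta_{(x_i,y_i)}\boxtimes e_i\}$, and let $X\widehat\boxtimes_\pi E$ be its completion. Let $\widehat T: X\widehat\boxtimes_\pi E\to F$ be the linearization of $T$, the unique bounded linear operator with $\widehat T(\delta_{(x,0)}\boxtimes e)=T(x,e)$ for all $x\in X$, $e\in E$. $T$ is called Cohen strongly $p$-summing if there is $C>0$ such that for all $n$,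 $x_i,y_i\in X$, $e_i\in E$, $z_i^*\in F^*$ ($1\le i\le n$), $$\sum_{i=1}^n|\langle T(x_i,e_i)-T(y_i,e_i),z_i^*\rangle|\le C\Big(\sum_{i=1}^n(d(x_i,y_i)\|e_i\|)^p\Big)^{1/p}\sup_{z^{**}\in B_{F^{**}}}\Big(\sum_{i=1}^n|z^{**}(z_i^*)|^{p^*}\Big)^{1/p^*},$$ and $d_p^{LipL}(T)$ is the infimum of such $C$. A bounded linear operator $u:G\to F$ from a Banach space $G$ is called strongly $p$-summing (in Cohen's sense) if there is $C>0$ such that for all $n$, $g_i\in G$, $z_i^*\in F^*$ ($1\le i\le n$), $$\sum_{i=1}^n|\langle u(g_i),z_i^*\rangle|\le C\Big(\sum_{i=1}^n\|g_i\|^p\Big)^{1/p}\sup_{z^{**}\in B_{F^{**}}}\Big(\sum_{i=1}^n|z^{**}(z_i^*)|^{p^*}\Big)^{1/p^*},$$ and $d_p(u)$ is the infimum of such $C$. (For $p=\infty$ the $\ell_p$-sum is replaced by the maximum.) Then $T$ is Cohen strongly $p$-summing if and only if $\widehat T$ is strongly $p$-summing, and in this case $d_p^{LipL}(T)=d_p(\widehat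 T)$. -/

import Mathlib

open scoped NNReal ENNReal

/-! A pointed metric space is a metric space `X` with a distinguished point `0 : X`,
provided by `[Zero X]`. All normed spaces are real; `StrongDual ℝ E` is the topological dual. -/

/-- The space `Lip₀(X; G)` of Lipschitz maps `X → G` vanishing at the base point. -/
def Lip0 (X G : Type*) [MetricSpace X] [Zero X] [NormedAddCommGroup G] [NormedSpace ℝ G] :
    Submodule ℝ (X → G) where
  carrier := {f | f 0 = 0 ∧ ∃ K : ℝ≥0, LipschitzWith K f}
  add_mem' := by
    rintro f g ⟨hf, K, hK⟩ ⟨hg, L, hL⟩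
    exact ⟨by simp [hf, hg], K + L, hK.add hL⟩
  zero_mem' := ⟨rfl, 0, LipschitzWith.const 0⟩
  smul_mem' := by
    rintro c f ⟨hf, K, hK⟩
    refine ⟨by simp [hf], ‖c‖₊ * K, LipschitzWith.of_dist_le_mul fun x y => ?_⟩
    have h := hK.dist_le_mul x y
    simp only [Pi.smul_apply, dist_smul₀, NNReal.coe_mul, coe_nnnorm, mul_assoc]
    gcongr

/-- The functional `δ_{(x,y)} ⊠ e` on `Lip₀(X; E*)`, `f ↦ ⟨f x - f y, e⟩`. -/
def lipElem {X E : Type*} [MetricSpace X] [Zero X] [NormedAddCommGroup E] [NormedSpace ℝ E]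
    (x y : X) (e : E) : Module.Dual ℝ (Lip0 X (StrongDual ℝ E)) where
  toFun f := (f.1 x - f.1 y) e
  map_add' f g := by simp; ring
  map_smul' c f := by simp; ring

/-- The Lipschitz tensor product `X ⊠ E`: the linear span of the functionals `δ_{(x,y)} ⊠ e`. -/
def LipTensor (X E : Type*) [MetricSpace X] [Zero X] [NormedAddCommGroup E] [NormedSpace ℝ E] :
    Type _ :=
  ↥(Submodule.span ℝ (Set.range fun t : X × X × E => lipElem t.1 t.2.1 t.2.2))

namespace LipTensor

variable {X E F : Type*} [MetricSpace X] [Zero X] [NormedAddCommGroup E] [NormedSpace ℝ E]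
  [NormedAddCommGroup F] [NormedSpace ℝ F]

noncomputable instance instAddCommGroup : AddCommGroup (LipTensor X E) :=
  inferInstanceAs (AddCommGroup ↥(Submodule.span ℝ
    (Set.range fun t : X × X × E => lipElem t.1 t.2.1 t.2.2)))

noncomputable instance instModule : Module ℝ (LipTensor X E) :=
  inferInstanceAs (Module ℝ ↥(Submodule.span ℝ
    (Set.range fun t : X × X × E => lipElem t.1 t.2.1 t.2.2)))

/-- The inclusion of `X ⊠ E` into the functionals on `Lip₀(X; E*)`. -/
noncomputable def toDual : LipTensor X E →ₗ[ℝ] Module.Dual ℝ (Lip0 X (StrongDual ℝ E)) :=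
  Submodule.subtype (Submodule.span ℝ
    (Set.range fun t : X × X × E => lipElem t.1 t.2.1 t.2.2))

theorem toDual_injective : Function.Injective (toDual (X := X) (E := E)) :=
  Subtype.val_injective

/-- `δ_{(x,y)} ⊠ e` as an element of `X ⊠ E`. -/
noncomputable def tmul (x y : X) (e : E) : LipTensor X E :=
  ⟨lipElem x y e, Submodule.subset_span ⟨(x, y, e), rfl⟩⟩

theorem toDual_tmul (x y : X) (e : E) : toDual (tmul x y e) = lipElem x y e := rfl

theorem smul_tmul (c : ℝ) (x y : X) (e : E) : c • tmul x y e = tmul x y (c • e) := by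
  apply toDual_injective
  ext f
  simp [toDual_tmul, lipElem]

/-- `Rep u n x y e`: the representation `u = ∑ i, δ_{(xᵢ,yᵢ)} ⊠ eᵢ`. -/
def Rep (u : LipTensor X E) (n : ℕ) (x y : Fin n → X) (e : Fin n → E) : Prop :=
  u = ∑ i, tmul (x i) (y i) (e i)

theorem Rep.add {u v : LipTensor X E} {n m : ℕ} {x y : Fin n → X} {e : Fin n → E}
    {x' y' : Fin m → X} {e' : Fin m → E} (hu : Rep u n x y e) (hv : Rep v m x' y' e') :
    Rep (u + v) (n + m) (Fin.append x x') (Fin.append y y') (Fin.append e e') := by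
  unfold Rep at *
  rw [Fin.sum_univ_add, hu, hv]
  simp

theorem Rep.smul {u : LipTensor X E} {n : ℕ} {x y : Fin n → X} {e : Fin n → E}
    (c : ℝ) (hu : Rep u n x y e) : Rep (c • u) n x y (fun i => c • e i) := by
  unfold Rep at *
  rw [hu, Finset.smul_sum]
  simp [smul_tmul]

theorem exists_rep (u : LipTensor X E) :
    ∃ (n : ℕ) (x y : Fin n → X) (e : Fin n → E), Rep u n x y e := by
  obtain ⟨u, hu⟩ := u
  induction hu using Submodule.span_induction with
  | mem v hv =>
    obtain ⟨⟨x, y, e⟩, rfl⟩ := hv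
    refine ⟨1, fun _ => x, fun _ => y, fun _ => e, ?_⟩
    simp only [Rep, Finset.univ_unique, Finset.sum_const, Finset.card_singleton, one_smul]
    rfl
  | zero => exact ⟨0, Fin.elim0, Fin.elim0, Fin.elim0, by simp [Rep]; rfl⟩
  | add v w hv hw h1 h2 =>
    obtain ⟨n, x, y, e, h1⟩ := h1
    obtain ⟨m, x', y', e', h2⟩ := h2
    exact ⟨_, _, _, _, h1.add h2⟩
  | smul c v hv h =>
    obtain ⟨n, x, y, e, h⟩ := h
    exact ⟨_, _, _, _, h.smul c⟩

/-- The values `∑ i, d(xᵢ,yᵢ) ‖eᵢ‖` over all representations of `u`. -/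
def repCosts (u : LipTensor X E) : Set ℝ :=
  {r | ∃ (n : ℕ) (x y : Fin n → X) (e : Fin n → E),
    Rep u n x y e ∧ r = ∑ i, dist (x i) (y i) * ‖e i‖}

/-- The Lipschitz projective norm `π(u)`. -/
noncomputable instance instNorm : Norm (LipTensor X E) where
  norm u := sInf (repCosts u)

theorem norm_def (u : LipTensor X E) : ‖u‖ = sInf (repCosts u) := rfl

theorem repCosts_nonneg {u : LipTensor X E} {r : ℝ} (hr : r ∈ repCosts u) : 0 ≤ r := by
  obtain ⟨n, x, y, e, -, rfl⟩ := hr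
  positivity

theorem repCosts_bddBelow (u : LipTensor X E) : BddBelow (repCosts u) :=
  ⟨0, fun _ hr => repCosts_nonneg hr⟩

theorem repCosts_nonempty (u : LipTensor X E) : (repCosts u).Nonempty := by
  obtain ⟨n, x, y, e, h⟩ := exists_rep u
  exact ⟨_, n, x, y, e, h, rfl⟩

theorem repCosts_add {u v : LipTensor X E} {r s : ℝ} (hr : r ∈ repCosts u) (hs : s ∈ repCosts v) :
    r + s ∈ repCosts (u + v) := by
  obtain ⟨n, x, y, e, h, rfl⟩ := hr
  obtain ⟨m, x', y', e', h', rfl⟩ := hs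
  exact ⟨_, _, _, _, h.add h', by rw [Fin.sum_univ_add]; simp⟩

theorem repCosts_smul (c : ℝ) {u : LipTensor X E} {r : ℝ} (hr : r ∈ repCosts u) :
    |c| * r ∈ repCosts (c • u) := by
  obtain ⟨n, x, y, e, h, rfl⟩ := hr
  refine ⟨_, _, _, _, h.smul c, ?_⟩
  rw [Finset.mul_sum]
  refine Finset.sum_congr rfl fun i _ => ?_
  rw [norm_smul, Real.norm_eq_abs]
  ring

theorem norm_smul_le_aux (c : ℝ) (u : LipTensor X E) : ‖c • u‖ ≤ |c| * ‖u‖ := by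
  rcases eq_or_ne c 0 with rfl | hc
  · obtain ⟨r, hr⟩ := repCosts_nonempty u
    have := csInf_le (repCosts_bddBelow _) (repCosts_smul 0 hr)
    simpa [norm_def] using this
  · have hc' : 0 < |c| := abs_pos.mpr hc
    rw [← div_le_iff₀' hc']
    refine le_csInf (repCosts_nonempty u) fun r hr => ?_
    rw [div_le_iff₀' hc']
    exact csInf_le (repCosts_bddBelow _) (repCosts_smul c hr)

theorem abs_toDual_le (u : LipTensor X E) (f : Lip0 X (StrongDual ℝ E)) (K : ℝ≥0)
    (hK : LipschitzWith K f.1) {r : ℝ} (hr : r ∈ repCosts u) : |toDual u f| ≤ K * r := by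
  obtain ⟨n, x, y, e, h, rfl⟩ := hr
  rw [h, map_sum, LinearMap.sum_apply, Finset.mul_sum]
  refine (Finset.abs_sum_le_sum_abs _ _).trans (Finset.sum_le_sum fun i _ => ?_)
  rw [toDual_tmul, ← mul_assoc, ← Real.norm_eq_abs]
  refine ((f.1 (x i) - f.1 (y i)).le_opNorm (e i)).trans ?_
  have := hK.dist_le_mul (x i) (y i)
  rw [dist_eq_norm] at this
  gcongr

theorem core : NormedSpace.Core ℝ (LipTensor X E) where
  norm_nonneg u := Real.sInf_nonneg fun _ hr => repCosts_nonneg hr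
  norm_smul c u := by
    refine le_antisymm (norm_smul_le_aux c u) ?_
    rcases eq_or_ne c 0 with rfl | hc
    · rw [norm_zero, zero_mul]
      exact Real.sInf_nonneg fun _ hr => repCosts_nonneg hr
    · have h := norm_smul_le_aux c⁻¹ (c • u)
      rw [smul_smul, inv_mul_cancel₀ hc, one_smul, abs_inv] at h
      rwa [Real.norm_eq_abs, ← le_inv_mul_iff₀ (abs_pos.mpr hc)]
  norm_triangle u v := by
    have h : ∀ r ∈ repCosts u, ∀ s ∈ repCosts v, ‖u + v‖ ≤ r + s := fun r hr s hs =>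
      csInf_le (repCosts_bddBelow _) (repCosts_add hr hs)
    have h1 : ∀ r ∈ repCosts u, ‖u + v‖ - r ≤ ‖v‖ := fun r hr =>
      le_csInf (repCosts_nonempty v) fun s hs => by linarith [h r hr s hs]
    have h2 : ‖u + v‖ - ‖v‖ ≤ ‖u‖ :=
      le_csInf (repCosts_nonempty u) fun r hr => by linarith [h1 r hr]
    linarith
  norm_eq_zero_iff u := by
    constructor
    · intro hu
      apply toDual_injective
      ext f
      obtain ⟨K, hK⟩ := f.2.2
      have h : |toDual u f| ≤ K * ‖u‖ := by
        rcases eq_or_ne K 0 with rfl | hK0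
        · obtain ⟨r, hr⟩ := repCosts_nonempty u
          simpa using abs_toDual_le u f 0 hK hr
        · have hpos : (0 : ℝ) < K := by positivity
          rw [← div_le_iff₀' hpos]
          refine le_csInf (repCosts_nonempty u) fun r hr => ?_
          rw [div_le_iff₀' hpos]
          exact abs_toDual_le u f K hK hr
      rw [hu, mul_zero] at h
      simpa using abs_nonpos_iff.mp h
    · rintro rfl
      have := norm_smul_le_aux 0 (0 : LipTensor X E)
      rw [zero_smul, abs_zero, zero_mul] at this
      exact le_antisymm this (Real.sInf_nonneg fun _ hr => repCosts_nonneg hr)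

noncomputable instance instNormedAddCommGroup : NormedAddCommGroup (LipTensor X E) :=
  NormedAddCommGroup.ofCore core

noncomputable instance instNormedSpace : NormedSpace ℝ (LipTensor X E) :=
  NormedSpace.ofCore core

end LipTensor

/-- The Banach space `X ⊠̂_π E`, the completion of `X ⊠ E` for the Lipschitz projective norm. -/
abbrev LipTensorCompletion (X E : Type*) [MetricSpace X] [Zero X] [NormedAddCommGroup E]
    [NormedSpace ℝ E] : Type _ :=
  UniformSpace.Completion (LipTensor X E)

/-- The space `LipL₀(X × E; F)` of Lip-linear operators `T : X × E → F` with `T(0, ·) = 0`. -/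
structure LipL0 (X E F : Type*) [MetricSpace X] [Zero X] [NormedAddCommGroup E] [NormedSpace ℝ E]
    [NormedAddCommGroup F] [NormedSpace ℝ F] where
  toFun : X × E → F
  map_add' : ∀ x e e', toFun (x, e + e') = toFun (x, e) + toFun (x, e')
  map_smul' : ∀ x (c : ℝ) e, toFun (x, c • e) = c • toFun (x, e)
  map_base' : ∀ e, toFun (0, e) = 0
  lipschitz' : ∃ C : ℝ, 0 < C ∧
    ∀ x y e, ‖toFun (x, e) - toFun (y, e)‖ ≤ C * dist x y * ‖e‖

namespace LipL0

variable {X E F : Type*} [MetricSpace X] [Zero X] [NormedAddCommGroup E] [NormedSpace ℝ E]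
  [NormedAddCommGroup F] [NormedSpace ℝ F]

instance : CoeFun (LipL0 X E F) fun _ => X × E → F := ⟨LipL0.toFun⟩

/-- The map `x ↦ ⟨T(x, ·), z*⟩` in `Lip₀(X; E*)`. -/
noncomputable def toLip0 (T : LipL0 X E F) (z : StrongDual ℝ F) : Lip0 X (StrongDual ℝ E) :=
  ⟨fun x => LinearMap.mkContinuousOfExistsBound
      { toFun := fun e => z (T (x, e))
        map_add' := fun e e' => by rw [T.map_add', map_add]
        map_smul' := fun c e => by rw [T.map_smul', map_smul]; rfl }
      (by
        obtain ⟨C, -, hC⟩ := T.lipschitz'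
        refine ⟨‖z‖ * (C * dist x 0), fun e => ?_⟩
        have h := hC x 0 e
        rw [T.map_base', sub_zero] at h
        refine (z.le_opNorm _).trans ?_
        rw [mul_assoc]
        gcongr), by
    refine ⟨?_, ?_⟩
    · ext e
      exact (congrArg z (T.map_base' e)).trans (map_zero z)
    · obtain ⟨C, hC0, hC⟩ := T.lipschitz'
      refine ⟨⟨‖z‖ * C, by positivity⟩, LipschitzWith.of_dist_le_mul fun x y => ?_⟩
      rw [dist_eq_norm]
      refine ContinuousLinearMap.opNorm_le_bound _
        (mul_nonneg (mul_nonneg (norm_nonneg z) hC0.le) dist_nonneg) fun e => ?_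
      have h : ‖z (T (x, e) - T (y, e))‖ ≤ ‖z‖ * (C * dist x y * ‖e‖) :=
        (z.le_opNorm _).trans (by gcongr; exact hC x y e)
      rw [map_sub] at h
      calc _ ≤ ‖z‖ * (C * dist x y * ‖e‖) := h
        _ = ‖z‖ * C * dist x y * ‖e‖ := by ring⟩

theorem toLip0_apply (T : LipL0 X E F) (z : StrongDual ℝ F) (x : X) (e : E) :
    (T.toLip0 z).1 x e = z (T (x, e)) := rfl

theorem sum_eq_toDual (T : LipL0 X E F) (z : StrongDual ℝ F) {u : LipTensor X E} {n : ℕ}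
    {x y : Fin n → X} {e : Fin n → E} (h : u.Rep n x y e) :
    z (∑ i, (T (x i, e i) - T (y i, e i))) = LipTensor.toDual u (T.toLip0 z) := by
  rw [h]
  simp [LipTensor.toDual_tmul, lipElem, toLip0_apply]

/-- The linearization on `X ⊠ E`:
`∑ i, δ_{(xᵢ,yᵢ)} ⊠ eᵢ ↦ ∑ i, (T(xᵢ,eᵢ) - T(yᵢ,eᵢ))`, independently of the representation
(see `algLinearization_rep`). -/
noncomputable def algLinearization (T : LipL0 X E F) : LipTensor X E →ₗ[ℝ] F :=
  have key : ∀ (z : StrongDual ℝ F) (u : LipTensor X E),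
      z (∑ i, (T (u.exists_rep.choose_spec.choose i,
            u.exists_rep.choose_spec.choose_spec.choose_spec.choose i)
          - T (u.exists_rep.choose_spec.choose_spec.choose i,
            u.exists_rep.choose_spec.choose_spec.choose_spec.choose i)))
        = LipTensor.toDual u (T.toLip0 z) := fun z u =>
    T.sum_eq_toDual z u.exists_rep.choose_spec.choose_spec.choose_spec.choose_spec
  { toFun := fun u => ∑ i, (T (u.exists_rep.choose_spec.choose i,
            u.exists_rep.choose_spec.choose_spec.choose_spec.choose i)
          - T (u.exists_rep.choose_spec.choose_spec.choose i,
            u.exists_rep.choose_spec.choose_spec.choose_spec.choose i))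
    map_add' := fun u v => by
      rw [SeparatingDual.eq_iff_forall_dual_eq (R := ℝ)]
      intro z
      rw [map_add, key, key, key, map_add, LinearMap.add_apply]
    map_smul' := fun c u => by
      rw [SeparatingDual.eq_iff_forall_dual_eq (R := ℝ)]
      intro z
      rw [map_smul, key, key, map_smul, LinearMap.smul_apply, RingHom.id_apply] }

theorem algLinearization_rep (T : LipL0 X E F) {u : LipTensor X E} {n : ℕ}
    {x y : Fin n → X} {e : Fin n → E} (h : u.Rep n x y e) :
    T.algLinearization u = ∑ i, (T (x i, e i) - T (y i, e i)) := by
  rw [SeparatingDual.eq_iff_forall_dual_eq (R := ℝ)]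
  intro z
  rw [T.sum_eq_toDual z h]
  exact T.sum_eq_toDual z u.exists_rep.choose_spec.choose_spec.choose_spec.choose_spec

theorem algLinearization_bound (T : LipL0 X E F) :
    ∃ C : ℝ, ∀ u, ‖T.algLinearization u‖ ≤ C * ‖u‖ := by
  obtain ⟨C, hC0, hC⟩ := T.lipschitz'
  refine ⟨C, fun u => ?_⟩
  rw [← div_le_iff₀' hC0]
  refine le_csInf (LipTensor.repCosts_nonempty u) ?_
  rintro _ ⟨n, x, y, e, h, rfl⟩
  rw [div_le_iff₀' hC0, T.algLinearization_rep h, Finset.mul_sum]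
  refine norm_sum_le_of_le _ fun i _ => ?_
  rw [← mul_assoc]
  exact hC _ _ _

/-- The linearization `T̂ : X ⊠̂_π E → F` of `T`: the continuous extension of the linearization
on `X ⊠ E` to the completion. -/
noncomputable def linearization [CompleteSpace F] (T : LipL0 X E F) :
    LipTensorCompletion X E →L[ℝ] F :=
  (T.algLinearization.mkContinuousOfExistsBound T.algLinearization_bound).extend
    UniformSpace.Completion.toComplL

/-- `T̂(δ_{(x,y)} ⊠ e) = T(x,e) - T(y,e)`. -/
theorem linearization_tmul [CompleteSpace F] (T : LipL0 X E F) (x y : X) (e : E) :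
    T.linearization (LipTensor.tmul x y e : LipTensorCompletion X E) = T (x, e) - T (y, e) := by
  have h := ContinuousLinearMap.extend_eq
    (T.algLinearization.mkContinuousOfExistsBound T.algLinearization_bound)
    (e := UniformSpace.Completion.toComplL (𝕜 := ℝ) (E := LipTensor X E))
    UniformSpace.Completion.denseRange_coe
    (UniformSpace.Completion.isUniformInducing_coe (LipTensor X E)) (LipTensor.tmul x y e)
  refine h.trans ?_
  have hr : (LipTensor.tmul x y e).Rep 1 (fun _ => x) (fun _ => y) (fun _ => e) := by
    simp [LipTensor.Rep]
  exact (T.algLinearization_rep hr).trans (by simp)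

end LipL0

/-- The `ℓ_pⁿ` norm of a real `n`-tuple, `p ∈ [1, ∞]` (the maximum of the moduli for `p = ∞`). -/
noncomputable def lpNormFin (p : ℝ≥0∞) {n : ℕ} (a : Fin n → ℝ) : ℝ :=
  ‖(WithLp.toLp p a : PiLp p fun _ : Fin n => ℝ)‖

/-- The weak `ℓ_qⁿ` norm `sup {‖(φ(zᵢ))ᵢ‖_q : φ ∈ B_{G*}}` of an `n`-tuple in `G`. -/
noncomputable def weakLpNorm (q : ℝ≥0∞) {G : Type*} [NormedAddCommGroup G] [NormedSpace ℝ G]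
    {n : ℕ} (z : Fin n → G) : ℝ :=
  ⨆ φ : Metric.closedBall (0 : StrongDual ℝ G) 1, lpNormFin q fun i => φ.1 (z i)

section Summing

variable {X E F G : Type*} [MetricSpace X] [Zero X] [NormedAddCommGroup E] [NormedSpace ℝ E]
  [NormedAddCommGroup F] [NormedSpace ℝ F] [NormedAddCommGroup G] [NormedSpace ℝ G]

/-- The constants `C > 0` in the definition of a strongly `p`-summing linear operator `u`. -/
def stronglySummingConsts (p : ℝ≥0∞) (u : G →L[ℝ] F) : Set ℝ :=
  {C | 0 < C ∧ ∀ (n : ℕ) (x : Fin n → G) (z : Fin n → StrongDual ℝ F),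
    ∑ i, |z i (u (x i))|
      ≤ C * lpNormFin p (fun i => ‖x i‖) * weakLpNorm (ENNReal.conjExponent p) z}

/-- `u` is strongly `p`-summing (in Cohen's sense): `u ∈ 𝒟_p(G; F)`. -/
def IsStronglySumming (p : ℝ≥0∞) (u : G →L[ℝ] F) : Prop :=
  (stronglySummingConsts p u).Nonempty

/-- The norm `d_p(u)`. -/
noncomputable def stronglySummingNorm (p : ℝ≥0∞) (u : G →L[ℝ] F) : ℝ :=
  sInf (stronglySummingConsts p u)

/-- The constants `C > 0` in the definition of a Cohen strongly `p`-summing Lip-linear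
operator `T`. -/
def LipL0.cohenSummingConsts (p : ℝ≥0∞) (T : LipL0 X E F) : Set ℝ :=
  {C | 0 < C ∧ ∀ (n : ℕ) (x y : Fin n → X) (e : Fin n → E) (z : Fin n → StrongDual ℝ F),
    ∑ i, |z i (T (x i, e i) - T (y i, e i))|
      ≤ C * lpNormFin p (fun i => dist (x i) (y i) * ‖e i‖)
        * weakLpNorm (ENNReal.conjExponent p) z}

/-- `T` is Cohen strongly `p`-summing: `T ∈ 𝒟_p^{LipL}(X × E; F)`. -/
def LipL0.IsCohenStronglySumming (p : ℝ≥0∞) (T : LipL0 X E F) : Prop :=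
  (T.cohenSummingConsts p).Nonempty

/-- The norm `d_p^{LipL}(T)`. -/
noncomputable def LipL0.cohenSummingNorm (p : ℝ≥0∞) (T : LipL0 X E F) : ℝ :=
  sInf (T.cohenSummingConsts p)

end Summing

/-! ### Weighted ℓ_p estimates -/

/-- A family of weights with sums at most one, raised to the power `1/p`, does not increase
`ℓ_p` norms. -/
theorem PiLp.norm_toLp_sigma_le {ι : Type*} [Fintype ι] {κ : ι → Type*} [∀ i, Fintype (κ i)]
    (p : ℝ≥0∞) [hp : Fact (1 ≤ p)] (s : ι → ℝ) (w : ∀ i, κ i → ℝ) (hw : ∀ i j, 0 ≤ w i j)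
    (hw1 : ∀ i, ∑ j, w i j ≤ 1) (a : (Σ i, κ i) → ℝ)
    (ha : ∀ t, |a t| ≤ |s t.1| * w t.1 t.2 ^ (p⁻¹).toReal) :
    ‖(WithLp.toLp p a : PiLp p fun _ : Σ i, κ i => ℝ)‖
      ≤ ‖(WithLp.toLp p s : PiLp p fun _ : ι => ℝ)‖ := by
  rcases eq_or_ne p ∞ with rfl | hp'
  · rw [PiLp.norm_eq_ciSup, PiLp.norm_eq_ciSup]
    -- Nonnegativity covers an empty index type, where the real supremum is 0 by default.
    have hnn : 0 ≤ ⨆ i, ‖s i‖ := Real.iSup_nonneg fun i => norm_nonneg _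
    refine Real.iSup_le (fun t => ?_) hnn
    have h := ha t
    simp only [ENNReal.inv_top, ENNReal.toReal_zero, Real.rpow_zero, mul_one] at h
    exact h.trans (le_ciSup (f := fun i => ‖s i‖) (Set.finite_range _).bddAbove t.1)
  · have h0 : 0 < p.toReal :=
      ENNReal.toReal_pos (zero_lt_one.trans_le hp.out).ne' hp'
    rw [PiLp.norm_eq_sum h0, PiLp.norm_eq_sum h0]
    refine Real.rpow_le_rpow (by positivity) ?_ (by positivity)
    rw [Fintype.sum_sigma]
    refine Finset.sum_le_sum fun i _ => ?_
    calc ∑ j, ‖a ⟨i, j⟩‖ ^ p.toReal ≤ ∑ j, ‖s i‖ ^ p.toReal * w i j := by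
          refine Finset.sum_le_sum fun j _ => ?_
          refine (Real.rpow_le_rpow (norm_nonneg _) (ha ⟨i, j⟩) h0.le).trans_eq ?_
          have hwp : 0 ≤ w i j ^ (p⁻¹).toReal := Real.rpow_nonneg (hw i j) _
          rw [Real.mul_rpow (abs_nonneg _) hwp, ← Real.rpow_mul (hw i j), ENNReal.toReal_inv,
            inv_mul_cancel₀ h0.ne', Real.rpow_one, Real.norm_eq_abs]
      _ = ‖s i‖ ^ p.toReal * ∑ j, w i j := by rw [Finset.mul_sum]
      _ ≤ ‖s i‖ ^ p.toReal := mul_le_of_le_one_right (by positivity) (hw1 i)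

/-- The case of one-point fibres with all weights equal to 1. -/
theorem PiLp.norm_toLp_mono {ι : Type*} [Fintype ι] (p : ℝ≥0∞) [Fact (1 ≤ p)] {a b : ι → ℝ}
    (h : ∀ i, |a i| ≤ |b i|) :
    ‖(WithLp.toLp p a : PiLp p fun _ : ι => ℝ)‖
      ≤ ‖(WithLp.toLp p b : PiLp p fun _ : ι => ℝ)‖ := by
  have h1 := PiLp.norm_toLp_sigma_le (κ := fun _ : ι => Unit) p b (fun _ _ => 1)
    (by simp) (by simp) (fun t => a t.1) (fun t => by simpa using h t.1)
  refine le_of_eq_of_le ?_ h1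
  exact ((LinearIsometryEquiv.piLpCongrLeft p ℝ ℝ (Equiv.sigmaPUnit ι).symm).norm_map
    (WithLp.toLp p a)).symm

theorem lpNormFin_reindex (p : ℝ≥0∞) [Fact (1 ≤ p)] {ι : Type*} [Fintype ι] {n : ℕ}
    (σ : ι ≃ Fin n) (a : ι → ℝ) :
    lpNormFin p (a ∘ σ.symm) = ‖(WithLp.toLp p a : PiLp p fun _ : ι => ℝ)‖ :=
  (LinearIsometryEquiv.piLpCongrLeft p ℝ ℝ σ).norm_map (WithLp.toLp p a)

/-! ### Weak norms and conjugate exponents -/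

section WeakNorm

variable {G : Type*} [NormedAddCommGroup G] [NormedSpace ℝ G]

theorem lpNormFin_nonneg (p : ℝ≥0∞) [Fact (1 ≤ p)] {n : ℕ} (a : Fin n → ℝ) :
    0 ≤ lpNormFin p a :=
  norm_nonneg _

theorem weakLpNorm_nonneg (q : ℝ≥0∞) [Fact (1 ≤ q)] {n : ℕ} (z : Fin n → G) :
    0 ≤ weakLpNorm q z :=
  Real.iSup_nonneg fun _ => lpNormFin_nonneg q _

theorem lpNormFin_le_weakLpNorm (q : ℝ≥0∞) [Fact (1 ≤ q)] {n : ℕ} (z : Fin n → G)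
    (φ : Metric.closedBall (0 : StrongDual ℝ G) 1) :
    lpNormFin q (fun i => φ.1 (z i)) ≤ weakLpNorm q z := by
  -- The norms ‖z_i‖ bound the family over the unit ball; an unbounded real supremum would be 0 by
  -- default.
  refine le_ciSup (f := fun φ : Metric.closedBall (0 : StrongDual ℝ G) 1 =>
    lpNormFin q fun i => φ.1 (z i)) ⟨lpNormFin q fun i => ‖z i‖, ?_⟩ φ
  rintro _ ⟨ψ, rfl⟩
  refine PiLp.norm_toLp_mono q fun i => ?_
  rw [abs_norm]
  exact (ψ.1.le_of_opNorm_le (mem_closedBall_zero_iff.mp ψ.2) (z i)).trans_eq (one_mul _)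

end WeakNorm

/-- Equality holds for w > 0. At w = 0 the left side vanishes, while the right side is 1 when a = 0,
which is the case p = ∞. -/
theorem Real.mul_inv_rpow_le_rpow {w a b : ℝ} (hw : 0 ≤ w) (hab : a + b = 1) :
    w * (w ^ b)⁻¹ ≤ w ^ a := by
  rcases hw.eq_or_lt with rfl | h
  · rw [zero_mul]
    exact Real.rpow_nonneg le_rfl a
  · rw [mul_inv_le_iff₀ (Real.rpow_pos_of_pos h b), ← Real.rpow_add h, hab, Real.rpow_one]

theorem continuous_lpNormFin (p : ℝ≥0∞) [Fact (1 ≤ p)] (n : ℕ) :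
    Continuous fun a : Fin n → ℝ => lpNormFin p a :=
  (PiLp.continuous_toLp p fun _ : Fin n => ℝ).norm

theorem ENNReal.HolderConjugate.toReal_inv_add_toReal_inv (p q : ℝ≥0∞)
    [h : ENNReal.HolderConjugate p q] : (p⁻¹).toReal + (q⁻¹).toReal = 1 := by
  have h1 := ENNReal.HolderConjugate.inv_add_inv_eq_one p q
  have hp : p⁻¹ ≠ ∞ := fun h => by simp [h] at h1
  have hq : q⁻¹ ≠ ∞ := fun h => by simp [h] at h1
  rw [← ENNReal.toReal_add hp hq, h1, ENNReal.toReal_one]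

/-! ### Elementary tensors and nearly optimal representations -/

namespace LipTensor

variable {X E : Type*} [MetricSpace X] [Zero X] [NormedAddCommGroup E] [NormedSpace ℝ E]

theorem norm_tmul_le (x y : X) (e : E) : ‖tmul x y e‖ ≤ dist x y * ‖e‖ :=
  csInf_le (repCosts_bddBelow _)
    ⟨1, fun _ => x, fun _ => y, fun _ => e, by simp [Rep], by simp⟩

theorem exists_rep_cost_lt {u : LipTensor X E} {s : ℝ} (h : ‖u‖ < s) :
    ∃ (n : ℕ) (x y : Fin n → X) (e : Fin n → E),
      Rep u n x y e ∧ ∑ i, dist (x i) (y i) * ‖e i‖ < s := by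
  obtain ⟨_, ⟨n, x, y, e, hr, rfl⟩, hs⟩ := exists_lt_of_csInf_lt (repCosts_nonempty u) h
  exact ⟨n, x, y, e, hr, hs⟩

end LipTensor

/-! ### Transfer of constants between `T` and its linearization -/

namespace LipL0

variable {X E F : Type*} [MetricSpace X] [Zero X] [NormedAddCommGroup E] [NormedSpace ℝ E]
  [NormedAddCommGroup F] [NormedSpace ℝ F]

theorem sub_eq_zero_of_dist_mul_norm (T : LipL0 X E F) {x y : X} {e : E}
    (h : dist x y * ‖e‖ = 0) : T (x, e) - T (y, e) = 0 := by
  obtain ⟨C, -, hC⟩ := T.lipschitz'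
  have := hC x y e
  rw [mul_assoc, h, mul_zero] at this
  exact norm_le_zero_iff.mp this

/-- Reindexing frees the defining inequality from `Fin n`, so that it applies to the pairs (i, j)
formed by tensors and the terms of their representations. -/
theorem sum_abs_le_of_mem_cohenSummingConsts {p : ℝ≥0∞} [Fact (1 ≤ p)] {T : LipL0 X E F} {C : ℝ}
    (hC : C ∈ T.cohenSummingConsts p) {ι : Type*} [Fintype ι] (x y : ι → X) (e : ι → E)
    (z : ι → StrongDual ℝ F) {A B : ℝ} (hB : 0 ≤ B)
    (hA : ‖(WithLp.toLp p fun i => dist (x i) (y i) * ‖e i‖ : PiLp p fun _ : ι => ℝ)‖ ≤ A)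
    (hz : ∀ φ : Metric.closedBall (0 : StrongDual ℝ (StrongDual ℝ F)) 1,
      ‖(WithLp.toLp p.conjExponent fun i => φ.1 (z i) :
        PiLp p.conjExponent fun _ : ι => ℝ)‖ ≤ B) :
    ∑ i, |z i (T (x i, e i) - T (y i, e i))| ≤ C * A * B := by
  have hpq := ENNReal.HolderConjugate.conjExponent (p := p) Fact.out
  have : Fact (1 ≤ p.conjExponent) := ⟨ENNReal.HolderConjugate.one_le p.conjExponent p⟩
  let σ := Fintype.equivFin ι
  have h := hC.2 _ (x ∘ σ.symm) (y ∘ σ.symm) (e ∘ σ.symm) (z ∘ σ.symm)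
  have h1 : ∑ i, |z i (T (x i, e i) - T (y i, e i))| =
      ∑ k, |(z ∘ σ.symm) k (T ((x ∘ σ.symm) k, (e ∘ σ.symm) k)
        - T ((y ∘ σ.symm) k, (e ∘ σ.symm) k))| :=
    (σ.symm.sum_comp fun i => |z i (T (x i, e i) - T (y i, e i))|).symm
  rw [h1]
  refine h.trans ?_
  have hA' := (lpNormFin_reindex p σ fun i => dist (x i) (y i) * ‖e i‖).trans_le hA
  have hB' : weakLpNorm p.conjExponent (z ∘ σ.symm) ≤ B :=
    Real.iSup_le (fun φ =>
      (lpNormFin_reindex p.conjExponent σ fun i => φ.1 (z i)).trans_le (hz φ)) hB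
  have h0 := lpNormFin_nonneg p ((fun i => dist (x i) (y i) * ‖e i‖) ∘ σ.symm)
  exact mul_le_mul (mul_le_mul_of_nonneg_left hA' hC.1.le) hB' (weakLpNorm_nonneg _ _)
    (mul_nonneg hC.1.le (h0.trans hA'))

theorem sum_abs_algLinearization_le_of_norm_lt {p : ℝ≥0∞} [Fact (1 ≤ p)] {T : LipL0 X E F} {C : ℝ}
    (hC : C ∈ T.cohenSummingConsts p) {n : ℕ} (u : Fin n → LipTensor X E) (s : Fin n → ℝ)
    (hs : ∀ i, ‖u i‖ < s i) (z : Fin n → StrongDual ℝ F) :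
    ∑ i, |z i (T.algLinearization (u i))|
      ≤ C * lpNormFin p s * weakLpNorm p.conjExponent z := by
  have hpq := ENNReal.HolderConjugate.conjExponent (p := p) Fact.out
  have : Fact (1 ≤ p.conjExponent) := ⟨ENNReal.HolderConjugate.one_le p.conjExponent p⟩
  have hab := ENNReal.HolderConjugate.toReal_inv_add_toReal_inv p p.conjExponent
  choose m x y e hr hlt using fun i => LipTensor.exists_rep_cost_lt (hs i)
  have hs0 : ∀ i, 0 < s i := fun i => (norm_nonneg (u i)).trans_lt (hs i)
  let w : ∀ i, Fin (m i) → ℝ := fun i j => dist (x i j) (y i j) * ‖e i j‖ / s i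
  have hw : ∀ i j, 0 ≤ w i j := fun i j => div_nonneg (by positivity) (hs0 i).le
  have hw1 : ∀ i, ∑ j, w i j ≤ 1 := fun i => by
    rw [← Finset.sum_div, div_le_one (hs0 i)]
    exact (hlt i).le
  -- The exponent 1/p* makes c_ij z_i cost nothing in the weak p*-norm and leaves w_ij^(1/p) for the
  -- vectors, as 1/p + 1/p* = 1.
  let c : ∀ i, Fin (m i) → ℝ := fun i j => w i j ^ (p.conjExponent⁻¹).toReal
  have hc : ∀ i j, 0 ≤ c i j := fun i j => Real.rpow_nonneg (hw i j) _
  have key := sum_abs_le_of_mem_cohenSummingConsts hC (ι := Σ i, Fin (m i))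
    (fun t => x t.1 t.2) (fun t => y t.1 t.2) (fun t => (c t.1 t.2)⁻¹ • e t.1 t.2)
    (fun t => c t.1 t.2 • z t.1) (A := lpNormFin p s) (weakLpNorm_nonneg p.conjExponent z)
    (PiLp.norm_toLp_sigma_le p s w hw hw1 _ fun t => ?_)
    (fun φ => (PiLp.norm_toLp_sigma_le p.conjExponent (fun i => φ.1 (z i)) w hw hw1 _ fun t =>
      ?_).trans (lpNormFin_le_weakLpNorm _ z φ))
  · refine le_trans ?_ key
    rw [Fintype.sum_sigma]
    refine Finset.sum_le_sum fun i _ => ?_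
    rw [T.algLinearization_rep (hr i), map_sum]
    refine (Finset.abs_sum_le_sum_abs _ _).trans (Finset.sum_le_sum fun j _ => le_of_eq ?_)
    dsimp only
    rw [T.map_smul', T.map_smul', ← smul_sub]
    -- When the weight vanishes, c_ij may be 0 and the scalings need not cancel, but the term itself
    -- is zero by the Lipschitz bound.
    rcases (hw i j).eq_or_lt with h0 | h0
    · have : dist (x i j) (y i j) * ‖e i j‖ = 0 := by
        have := h0.symm
        rwa [div_eq_zero_iff, or_iff_left (hs0 i).ne'] at this
      simp [T.sub_eq_zero_of_dist_mul_norm this]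
    · have hc0 : c i j ≠ 0 := (Real.rpow_pos_of_pos h0 _).ne'
      rw [map_smul, smul_apply, smul_smul, inv_mul_cancel₀ hc0, one_smul]
  -- The rescaled cost is s_i w_ij / w_ij^(1/p*), hence at most s_i w_ij^(1/p).
  · have hd : dist (x t.1 t.2) (y t.1 t.2) * ‖e t.1 t.2‖ = s t.1 * w t.1 t.2 :=
      (mul_div_cancel₀ _ (hs0 t.1).ne').symm
    rw [norm_smul, norm_inv, Real.norm_of_nonneg (hc _ _), mul_left_comm, hd,
      abs_of_nonneg (mul_nonneg (inv_nonneg.mpr (hc _ _))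
        (mul_nonneg (hs0 _).le (hw _ _))), mul_left_comm, abs_of_pos (hs0 _), mul_comm (c _ _)⁻¹]
    exact mul_le_mul_of_nonneg_left (Real.mul_inv_rpow_le_rpow (hw _ _) hab) (hs0 _).le
  · rw [map_smul, smul_eq_mul, abs_mul, abs_of_nonneg (hc _ _), mul_comm]

/-- The infimum defining π need not be attained, so the strict bound is applied to s_i = ‖u_i‖ + ε
and ε tends to 0 from above. -/
theorem sum_abs_algLinearization_le {p : ℝ≥0∞} [Fact (1 ≤ p)] {T : LipL0 X E F} {C : ℝ}
    (hC : C ∈ T.cohenSummingConsts p) {n : ℕ} (u : Fin n → LipTensor X E)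
    (z : Fin n → StrongDual ℝ F) :
    ∑ i, |z i (T.algLinearization (u i))|
      ≤ C * lpNormFin p (fun i => ‖u i‖) * weakLpNorm p.conjExponent z := by
  have hcont : Continuous fun ε : ℝ =>
      C * lpNormFin p (fun i => ‖u i‖ + ε) * weakLpNorm p.conjExponent z :=
    (((continuous_lpNormFin p n).comp (by fun_prop :
      Continuous fun (ε : ℝ) (i : Fin n) => ‖u i‖ + ε)).const_mul C).mul_const _
  have hlim := (hcont.tendsto 0).mono_left (nhdsWithin_le_nhds (s := Set.Ioi (0 : ℝ)))
  simp only [add_zero] at hlim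
  refine ge_of_tendsto hlim ?_
  filter_upwards [self_mem_nhdsWithin] with ε hε
  exact sum_abs_algLinearization_le_of_norm_lt hC u _ (fun i => lt_add_of_pos_right _ hε) z

theorem linearization_coe [CompleteSpace F] (T : LipL0 X E F) (u : LipTensor X E) :
    T.linearization (u : LipTensorCompletion X E) = T.algLinearization u :=
  ContinuousLinearMap.extend_eq
    (T.algLinearization.mkContinuousOfExistsBound T.algLinearization_bound)
    (e := UniformSpace.Completion.toComplL (𝕜 := ℝ) (E := LipTensor X E))
    UniformSpace.Completion.denseRange_coe
    (UniformSpace.Completion.isUniformInducing_coe (LipTensor X E)) u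

/-- For fixed z, both sides are continuous in the tuple g, so the inequality passes from tuples in X
⊠ E to its completion with the same constant. -/
theorem cohenSummingConsts_subset [CompleteSpace F] (p : ℝ≥0∞) [Fact (1 ≤ p)] (T : LipL0 X E F) :
    T.cohenSummingConsts p ⊆ stronglySummingConsts p T.linearization := by
  refine fun C hC => ⟨hC.1, fun n g z => ?_⟩
  have hdense : DenseRange (Pi.map fun (_ : Fin n) (u : LipTensor X E) =>
      (u : LipTensorCompletion X E)) :=
    DenseRange.piMap fun _ => UniformSpace.Completion.denseRange_coe
  refine isClosed_property hdense (p := fun g => ∑ i, |z i (T.linearization (g i))|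
    ≤ C * lpNormFin p (fun i => ‖g i‖) * weakLpNorm p.conjExponent z) ?_ ?_ g
  · refine isClosed_le (by fun_prop) ?_
    exact (((continuous_lpNormFin p n).comp (by fun_prop :
      Continuous fun (g : Fin n → LipTensorCompletion X E) (i : Fin n) => ‖g i‖)).const_mul
        C).mul_const _
  · intro u
    simp only [Pi.map_apply, linearization_coe, UniformSpace.Completion.norm_coe]
    exact sum_abs_algLinearization_le hC u z

theorem stronglySummingConsts_subset [CompleteSpace F] (p : ℝ≥0∞) [Fact (1 ≤ p)]
    (T : LipL0 X E F) :
    stronglySummingConsts p T.linearization ⊆ T.cohenSummingConsts p := by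
  refine fun C hC => ⟨hC.1, fun n x y e z => ?_⟩
  have hpq := ENNReal.HolderConjugate.conjExponent (p := p) Fact.out
  have : Fact (1 ≤ p.conjExponent) := ⟨ENNReal.HolderConjugate.one_le p.conjExponent p⟩
  have h := hC.2 n (fun i => (LipTensor.tmul (x i) (y i) (e i) : LipTensorCompletion X E)) z
  simp only [linearization_tmul, UniformSpace.Completion.norm_coe] at h
  refine h.trans (mul_le_mul_of_nonneg_right (mul_le_mul_of_nonneg_left ?_ hC.1.le)
    (weakLpNorm_nonneg _ _))
  refine PiLp.norm_toLp_mono p fun i => ?_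
  rw [abs_norm]
  exact (LipTensor.norm_tmul_le _ _ _).trans (le_abs_self _)

theorem cohenSummingConsts_eq [CompleteSpace F] (p : ℝ≥0∞) [Fact (1 ≤ p)] (T : LipL0 X E F) :
    T.cohenSummingConsts p = stronglySummingConsts p T.linearization :=
  (T.cohenSummingConsts_subset p).antisymm (T.stronglySummingConsts_subset p)

end LipL0

theorem mainTheorem3 {X E F : Type*} [MetricSpace X] [Zero X]
    [NormedAddCommGroup E] [NormedSpace ℝ E] [CompleteSpace E]
    [NormedAddCommGroup F] [NormedSpace ℝ F] [CompleteSpace F]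
    (p : ℝ≥0∞) (hp : 1 < p) (T : LipL0 X E F) :
    (T.IsCohenStronglySumming p ↔ IsStronglySumming p T.linearization) ∧
      (T.IsCohenStronglySumming p → T.cohenSummingNorm p = stronglySummingNorm p T.linearization) := by
  have : Fact (1 ≤ p) := ⟨hp.le⟩
  unfold LipL0.IsCohenStronglySumming IsStronglySumming LipL0.cohenSummingNorm stronglySummingNorm
  rw [T.cohenSummingConsts_eq p]
  exact ⟨Iff.rfl, fun _ => rfl⟩
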